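/- Let $n\ge 1$ and let $A\in\mathbb{R}^{n\times n}$ be a matrix all of whose entries are nonnegative. Definitions. For $q\in\mathbb{R}^n$, the linear complementarity problem LCP$(A,q)$ asks for $x\in\mathbb{R}^n$ with $x\ge 0$, $y=Ax+q\ge 0$ and $x^Ty=0$ (inequalities between vectors are entrywise). $A$ is a $Q$-matrix if LCP$(A,q)$ has a solution for every $q\in\mathbb{R}^n$. For a nonempty set $K\subseteq\mathbb{R}^n_+$, let $K^*=\{y\in\mathbb{R}^n : x^Ty\ge 0 \text{ for all } x\in K\}$, and let LCP$(A,K,q)$ be the problem of finding $x\in K$ with $y=Ax+q\in K^*$ and $x^Ty=0$. $A$ is Karamardian if, for $K=\mathbb{R}^n_+\cap R(A)$, where $R(A)$ is the range (column space) of $A$, one has $K\neq\{0\}$ and there is some $d$ in the interior of $K^*$ such that zero is the only solution of LCP$(A,K,0)$ and the only solution of LCP$(A,K,d)$. Theorem. (1) If $A$ is nonsingular, then $A$ is Karamardian if and only if $A$ is a $Q$-matrix. (2) If $A$ is nonsingular and has at least one zero diagonal entry, then $A$ is not Karamardian. (3) If all diagonal entries of $A$ are positive (whether or not $A$ is nonsingular),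 then $A$ is Karamardian. (4) $A$ is a $Q$-matrix if and only if all diagonal entries of $A$ are positive (whether or not $A$ is nonsingular). -/

import Mathlib

namespace LCP

/-- A matrix is nonnegative if all its entries are nonnegative. -/
def Nonneg {n : ℕ} (A : Matrix (Fin n) (Fin n) ℝ) : Prop :=
  ∀ i j, 0 ≤ A i j

/-- The solution set of the linear complementarity problem `LCP(A, q)`:
all `x ≥ 0` such that `y = A x + q ≥ 0` and `xᵀ y = 0`. -/
def solutions {n : ℕ} (A : Matrix (Fin n) (Fin n) ℝ) (q : Fin n → ℝ) : Set (Fin n → ℝ) :=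
  {x | 0 ≤ x ∧ 0 ≤ A.mulVec x + q ∧ x ⬝ᵥ (A.mulVec x + q) = 0}

/-- `A` is a `Q`-matrix if `LCP(A, q)` has a solution for every `q`. -/
def IsQMatrix {n : ℕ} (A : Matrix (Fin n) (Fin n) ℝ) : Prop :=
  ∀ q : Fin n → ℝ, (solutions A q).Nonempty

/-- The dual `K* = {y | xᵀ y ≥ 0 for all x ∈ K}`. -/
def dual {n : ℕ} (K : Set (Fin n → ℝ)) : Set (Fin n → ℝ) :=
  {y | ∀ x ∈ K, 0 ≤ x ⬝ᵥ y}

/-- The solution set of the complementarity problem `LCP(A, K, q)`: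
all `x ∈ K` such that `y = A x + q ∈ K*` and `xᵀ y = 0`. -/
def coneSolutions {n : ℕ} (A : Matrix (Fin n) (Fin n) ℝ) (K : Set (Fin n → ℝ))
    (q : Fin n → ℝ) : Set (Fin n → ℝ) :=
  {x | x ∈ K ∧ A.mulVec x + q ∈ dual K ∧ x ⬝ᵥ (A.mulVec x + q) = 0}

/-- The intersection of the nonnegative orthant with the range (column space) of `A`. -/
def rangeCone {n : ℕ} (A : Matrix (Fin n) (Fin n) ℝ) : Set (Fin n → ℝ) :=
  {x | 0 ≤ x} ∩ Set.range A.mulVec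

/-- `A` is Karamardian if `K = ℝⁿ₊ ∩ R(A)` is not `{0}` and, for some `d` in the interior of `K*`,
zero is the unique solution of both `LCP(A, K, 0)` and `LCP(A, K, d)`. -/
def IsKaramardian {n : ℕ} (A : Matrix (Fin n) (Fin n) ℝ) : Prop :=
  rangeCone A ≠ {0} ∧
    coneSolutions A (rangeCone A) 0 = {0} ∧
    ∃ d ∈ interior (dual (rangeCone A)), coneSolutions A (rangeCone A) d = {0}

end LCP

open MeasureTheory Metric Set Filter Topology
open scoped NNReal

/-! ### Volume identity behind Brouwer's theorem -/

section Brouwer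

/-! Everything turns on the diagonal. If it is positive, `xᵀ(Ax + d) = 0` with `x, d ≥ 0` forces
each `a_ii x_i² = 0`, so zero is the only cone solution. If `a_ii = 0` and `A` is nonsingular, then
`K` is the whole orthant and `e_i` solves the homogeneous problem. A zero `a_ii` also rules out `Q`,
by an explicit `q`.

The deep step is positive diagonal implies `Q`: solutions are the fixed points of `x ↦ max(0, x -
(Ax + q))`. Clamping at a large `M` bounds this map, Brouwer gives a fixed point, and the positive
diagonal keeps the upper clamp inactive. Only Lipschitz Brouwer is needed; it is proved by the
volume-polynomial argument. -/

theorem ContinuousLinearMap.exists_polynomial_eval_eq_det {E : Type*} [NormedAddCommGroup E]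
    [NormedSpace ℝ E] [FiniteDimensional ℝ E] (M : E →L[ℝ] E) :
    ∃ P : Polynomial ℝ, P.natDegree ≤ Module.finrank ℝ E ∧
      ∀ t : ℝ, P.eval t = (1 + t • M).det := by
  classical
  let b := Module.finBasis ℝ E
  let B := LinearMap.toMatrix b b M.toLinearMap
  refine ⟨((Polynomial.X : Polynomial ℝ) • B.map Polynomial.C +
    (1 : Matrix _ _ ℝ).map Polynomial.C).det, ?_, fun t => ?_⟩
  · simpa using Polynomial.natDegree_det_X_add_C_le B 1
  · rw [ContinuousLinearMap.det, ← LinearMap.det_toMatrix b, ← Polynomial.coe_evalRingHom,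
      RingHom.map_det]
    congr 1
    ext i j
    simp [B, Matrix.one_apply, add_comm, LinearMap.toMatrix_apply,
      Module.Basis.repr_self, Finsupp.single_apply, apply_ite, eq_comm, mul_comm t]

variable {E : Type*} [NormedAddCommGroup E] [NormedSpace ℝ E] [FiniteDimensional ℝ E]
  [MeasurableSpace E] [BorelSpace E]

/-- For small `t > 0`, `id + t h` is a bijection of the space fixing the complement of the ball,
hence preserves the ball; change of variables then gives its volume. -/
theorem LipschitzWith.eventually_setIntegral_det_one_add_smul_fderiv (μ : Measure E)
    [μ.IsAddHaarMeasure] {h : E → E} {K : ℝ≥0} {R : ℝ} (hh : LipschitzWith K h)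
    (h0 : ∀ x, R ≤ ‖x‖ → h x = 0) :
    ∀ᶠ t : ℝ in 𝓝[>] 0,
      ∫ x in ball 0 R, (1 + t • fderiv ℝ h x).det ∂μ = μ.real (ball 0 R) := by
  obtain ⟨δ₁, hδ₁, hdet⟩ : ∃ δ > 0, ∀ M : E →L[ℝ] E, dist M 1 < δ → 0 < M.det := by
    have hc : Tendsto (fun M : E →L[ℝ] E => M.det) (𝓝 1) (𝓝 1) := by
      have := (ContinuousLinearMap.continuous_det (𝕜 := ℝ) (E := E)).tendsto 1
      simpa [ContinuousLinearMap.det] using this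
    exact Metric.eventually_nhds_iff.1 (hc.eventually (lt_mem_nhds one_pos))
  obtain ⟨δ₂, hvol, hδ₂⟩ := ((addHaar_image_le_mul_of_det_lt μ (1 : E →L[ℝ] E) (m := 2)
    (by simp [ContinuousLinearMap.det])).and self_mem_nhdsWithin).exists
  have hlim : Tendsto (fun t : ℝ => t * K) (𝓝[>] 0) (𝓝 0) := by
    have : Tendsto (fun t : ℝ => t * K) (𝓝 0) (𝓝 (0 * K)) := tendsto_id.mul_const _
    simpa using this.mono_left nhdsWithin_le_nhds
  have hδ₂' : (0 : ℝ) < δ₂ := hδ₂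
  filter_upwards [hlim.eventually (gt_mem_nhds hδ₁), hlim.eventually (gt_mem_nhds hδ₂'),
    hlim.eventually (gt_mem_nhds one_pos), self_mem_nhdsWithin] with t ht₁ ht₂ ht₃ ht
  have ht : 0 < t := ht
  set f : E → E := fun x => x + t • h x with hf
  have happ : ∀ s, ApproximatesLinearOn f (1 : E →L[ℝ] E) s (.mk (t * K) (by positivity)) := by
    intro s x _ y _
    have : f x - f y - (1 : E →L[ℝ] E) (x - y) = t • (h x - h y) := by
      simp only [hf, one_apply_eq_self, smul_sub]; abel
    rw [this, norm_smul, Real.norm_of_nonneg ht.le, NNReal.coe_mk, mul_assoc]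
    gcongr
    exact hh.norm_sub_le x y
  have hcond : Subsingleton E ∨ NNReal.mk (t * K) (by positivity) <
      ‖((ContinuousLinearEquiv.refl ℝ E).symm : E →L[ℝ] E)‖₊⁻¹ := by
    rcases subsingleton_or_nontrivial E with hE | hE
    · exact Or.inl hE
    · right
      have : ‖((ContinuousLinearEquiv.refl ℝ E).symm : E →L[ℝ] E)‖₊ = 1 := by
        ext; exact ContinuousLinearMap.norm_id
      rw [this, inv_one]
      exact ht₃
  have hinj : Function.Injective f :=
    injOn_univ.1 ((happ univ).injOn (f' := ContinuousLinearEquiv.refl ℝ E) hcond)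
  have hsurj : Function.Surjective f :=
    (happ univ).surjective (f' := ContinuousLinearEquiv.refl ℝ E) hcond
  have hfix : ∀ x, R ≤ ‖x‖ → f x = x := fun x hx => by simp [hf, h0 x hx]
  have hball : f '' ball 0 R = ball 0 R := by
    ext y
    simp only [mem_image, mem_ball_zero_iff]
    constructor
    · rintro ⟨x, hx, rfl⟩
      by_contra! hy
      have := hinj (hfix _ hy)
      rw [this] at hy
      linarith
    · intro hy
      obtain ⟨x, rfl⟩ := hsurj y
      refine ⟨x, ?_, rfl⟩
      by_contra! hx
      rw [hfix x hx] at hy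
      linarith
  set D := {x | DifferentiableAt ℝ h x}
  have hD : μ Dᶜ = 0 := hh.ae_differentiableAt
  have hDm : MeasurableSet D := measurableSet_of_differentiableAt ℝ h
  have himg : μ (f '' (ball 0 R ∩ D)) = μ (ball 0 R) := by
    -- `f` expands measure by a factor of at most 2, so it sends the null set of
    -- non-differentiability to a null set.
    have h1 : μ (f '' Dᶜ) = 0 := by
      have := hvol Dᶜ f ((happ _).mono_num ht₂.le)
      simpa [hD] using this
    have h2 : f '' (ball 0 R ∩ D) = ball 0 R \ f '' Dᶜ := by
      rw [image_inter hinj, hball, image_compl_eq ⟨hinj, hsurj⟩, sdiff_compl]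
    rw [h2, measure_sdiff_null h1]
  have hderiv : ∀ x ∈ ball 0 R ∩ D, HasFDerivWithinAt f (1 + t • fderiv ℝ h x)
      (ball 0 R ∩ D) x := fun x hx =>
    ((hasFDerivAt_id x).add (hx.2.hasFDerivAt.const_smul t)).hasFDerivWithinAt
  have hpos : ∀ x, 0 < (1 + t • fderiv ℝ h x).det := fun x => by
    apply hdet
    rw [dist_eq_norm, add_sub_cancel_left, norm_smul, Real.norm_of_nonneg ht.le]
    refine lt_of_le_of_lt ?_ ht₁
    gcongr
    exact norm_fderiv_le_of_lipschitz ℝ hh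
  have hres : μ.restrict (ball 0 R ∩ D) = μ.restrict (ball 0 R) := by
    apply Measure.restrict_congr_set
    exact inter_ae_eq_left_of_ae_eq_univ (eventuallyEq_univ.2 hh.ae_differentiableAt)
  have hlint := lintegral_abs_det_fderiv_eq_addHaar_image μ (measurableSet_ball.inter hDm)
    hderiv hinj.injOn
  rw [himg, hres] at hlint
  rw [integral_eq_lintegral_of_nonneg_ae (ae_of_all _ fun x => (hpos x).le)]
  · rw [measureReal_def, ← hlint]
    simp_rw [abs_of_pos (hpos _)]
  · exact (ContinuousLinearMap.continuous_det.measurable.comp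
      (measurable_const.add ((measurable_fderiv ℝ h).const_smul t))).aestronglyMeasurable

/-- The integrand is polynomial in `t` of degree at most `finrank`, so interpolation at `finrank +
1` small nodes carries the identity to `t = 1`. -/
theorem LipschitzWith.setIntegral_det_one_add_fderiv (μ : Measure E)
    [μ.IsAddHaarMeasure] {h : E → E} {K : ℝ≥0} {R : ℝ} (hh : LipschitzWith K h)
    (h0 : ∀ x, R ≤ ‖x‖ → h x = 0) :
    ∫ x in ball 0 R, (1 + fderiv ℝ h x).det ∂μ = μ.real (ball 0 R) := by
  obtain ⟨δ, hδ, hsub⟩ := mem_nhdsGT_iff_exists_Ioo_subset.1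
    (hh.eventually_setIntegral_det_one_add_smul_fderiv μ h0)
  obtain ⟨s, hs, hcard⟩ := (Ioo_infinite (mem_Ioi.1 hδ)).exists_subset_card_eq (Module.finrank ℝ E + 1)
  have hne : s.Nonempty := Finset.card_pos.1 (by omega)
  have hinj : Set.InjOn (id : ℝ → ℝ) s := Function.injective_id.injOn
  have key : ∀ M : E →L[ℝ] E, (1 + M).det =
      ∑ t ∈ s, (1 + t • M).det * (Lagrange.basis s id t).eval 1 := by
    intro M
    obtain ⟨P, hP, hPe⟩ := M.exists_polynomial_eval_eq_det
    have := Lagrange.eq_interpolate (f := P) hinj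
      (Polynomial.degree_le_natDegree.trans_lt (by rw [hcard]; exact_mod_cast Nat.lt_succ_of_le hP))
    have h1 := congrArg (Polynomial.eval 1) this
    rw [hPe, Lagrange.interpolate_apply, Polynomial.eval_finsetSum] at h1
    simpa only [hPe, one_smul, Polynomial.eval_mul, Polynomial.eval_C, id] using h1
  have hint : ∀ t : ℝ, IntegrableOn (fun x => (1 + t • fderiv ℝ h x).det) (ball 0 R) μ := by
    intro t
    obtain ⟨C, hC⟩ : ∃ C, ∀ M ∈ closedBall (0 : E →L[ℝ] E) K, ‖(1 + t • M).det‖ ≤ C :=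
      (isCompact_closedBall (0 : E →L[ℝ] E) (K : ℝ)).exists_bound_of_continuousOn
        (ContinuousLinearMap.continuous_det.comp (by fun_prop)).continuousOn
    refine Measure.integrableOn_of_bounded (M := C) measure_ball_lt_top.ne
      (ContinuousLinearMap.continuous_det.measurable.comp
      (measurable_const.add ((measurable_fderiv ℝ h).const_smul t))).aestronglyMeasurable
      (ae_of_all _ fun x => hC _ ?_)
    simpa using norm_fderiv_le_of_lipschitz ℝ hh
  have hsum : ∑ t ∈ s, (Lagrange.basis s id t).eval 1 = 1 := by
    rw [← Polynomial.eval_finsetSum, Lagrange.sum_basis hinj hne, Polynomial.eval_one]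
  rw [funext fun x => key (fderiv ℝ h x), integral_finsetSum _ fun t _ => (hint t).mul_const _]
  simp_rw [integral_mul_const]
  rw [Finset.sum_congr rfl fun t ht => by rw [hsub (hs ht)], ← Finset.mul_sum, hsum, mul_one]

end Brouwer

/-! ### Brouwer's fixed point theorem for Lipschitz maps -/

section FixedPoint
variable {E : Type*} [NormedAddCommGroup E] [InnerProductSpace ℝ E] [FiniteDimensional ℝ E]

/-- A Lipschitz map which is the identity outside a ball cannot send the ball into its sphere. -/
theorem LipschitzWith.exists_norm_add_ne {h : E → E} {K : ℝ≥0} {R : ℝ} (hR : 0 < R)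
    (hh : LipschitzWith K h) (h0 : ∀ x, R ≤ ‖x‖ → h x = 0) :
    ∃ x ∈ ball (0 : E) R, ‖x + h x‖ ≠ R := by
  by_contra! hc
  borelize E
  have hint := hh.setIntegral_det_one_add_fderiv volume h0
  have hzero : ∫ x in ball 0 R, (1 + fderiv ℝ h x).det = 0 := by
    rw [← integral_zero E ℝ (μ := volume.restrict (ball (0 : E) R))]
    apply setIntegral_congr_ae measurableSet_ball
    filter_upwards [hh.ae_differentiableAt] with x hx hxb
    have hd : HasFDerivAt (fun y => y + h y) (1 + fderiv ℝ h x) x :=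
      (hasFDerivAt_id x).add hx.hasFDerivAt
    have hd2 := hd.norm_sq
    have hcst : HasFDerivAt (fun y => ‖y + h y‖ ^ 2) (0 : E →L[ℝ] ℝ) x := by
      refine (hasFDerivAt_const (R ^ 2) x).congr_of_eventuallyEq ?_
      filter_upwards [isOpen_ball.mem_nhds hxb] with y hy
      rw [hc y hy]
    have hz := hd2.unique hcst
    -- Since `‖y + h y‖²` is locally constant, `x + h x` is orthogonal to the range of `1 + h'(x)`.
    -- Were that map onto, `x + h x` would be orthogonal to itself, although its norm is `R > 0`.
    by_contra hdet
    have hu : IsUnit (LinearMap.det (1 + fderiv ℝ h x).toLinearMap) := isUnit_iff_ne_zero.2 hdet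
    obtain ⟨v, hv⟩ := ((Module.End.isUnit_iff _).1
      ((LinearMap.isUnit_iff_isUnit_det _).2 hu)).2 (x + h x)
    have := congrArg (fun L => L v) hz
    have hv' : (1 + fderiv ℝ h x) v = x + h x := hv
    simp only [_root_.smul_apply, ContinuousLinearMap.comp_apply, hv',
      innerSL_apply_apply, real_inner_self_eq_norm_sq, hc x hxb] at this
    simp [hR.ne'] at this
  rw [hzero] at hint
  have : 0 < volume.real (ball (0 : E) R) :=
    ENNReal.toReal_pos (measure_ball_pos volume 0 hR).ne' measure_ball_lt_top.ne
  linarith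

omit [FiniteDimensional ℝ E] in
theorem lipschitzWith_smul_of_norm_le {X : Type*} [PseudoMetricSpace X] {m : X → ℝ} {u : X → E}
    {a b A B : ℝ≥0} (hm : LipschitzWith a m) (hu : LipschitzWith b u) (hA : ∀ x, |m x| ≤ A)
    (hB : ∀ x, ‖u x‖ ≤ B) : LipschitzWith (A * b + a * B) fun x => m x • u x := by
  refine LipschitzWith.of_dist_le_mul fun x y => ?_
  have h1 := hm.dist_le_mul x y
  have h2 := hu.dist_le_mul x y
  have e : m x • u x - m y • u y = m x • (u x - u y) + (m x - m y) • u y := by module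
  rw [Real.dist_eq] at h1
  rw [dist_eq_norm] at h2
  rw [dist_eq_norm, e]
  calc _ ≤ |m x| * ‖u x - u y‖ + |m x - m y| * ‖u y‖ := by
        simpa [norm_smul] using norm_add_le (m x • (u x - u y)) ((m x - m y) • u y)
    _ ≤ A * (b * dist x y) + (a * dist x y) * B := by
        gcongr
        · exact hA x
        · exact hB y
    _ = _ := by push_cast; ring

omit [FiniteDimensional ℝ E] in
theorem lipschitzWith_inv_norm_smul {X : Type*} [PseudoMetricSpace X] {g : X → E} {K ε : ℝ≥0}
    (hε : 0 < ε) (hg : LipschitzWith K g) (hgε : ∀ x, ε ≤ ‖g x‖) :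
    LipschitzWith (2 * K / ε) fun x => ‖g x‖⁻¹ • g x := by
  refine LipschitzWith.of_dist_le_mul fun x y => ?_
  have hε' : (0 : ℝ) < ε := hε
  have hx := hε'.trans_le (hgε x)
  have hy := hε'.trans_le (hgε y)
  have h1 := hg.dist_le_mul x y
  rw [dist_eq_norm] at h1
  have e : ‖g x‖⁻¹ • g x - ‖g y‖⁻¹ • g y
      = ‖g x‖⁻¹ • (g x - g y) + (‖g x‖⁻¹ * (‖g y‖ - ‖g x‖) * ‖g y‖⁻¹) • g y := by
    have : ‖g x‖⁻¹ * (‖g y‖ - ‖g x‖) * ‖g y‖⁻¹ = ‖g x‖⁻¹ - ‖g y‖⁻¹ := by field_simp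
    rw [this]; module
  rw [dist_eq_norm, e]
  calc _ ≤ ‖g x‖⁻¹ * ‖g x - g y‖ + ‖g x‖⁻¹ * |‖g y‖ - ‖g x‖| * ‖g y‖⁻¹ * ‖g y‖ := by
        refine (norm_add_le _ _).trans (le_of_eq ?_)
        simp [norm_smul, mul_assoc]
    _ = ‖g x‖⁻¹ * (‖g x - g y‖ + |‖g x‖ - ‖g y‖|) := by
        rw [inv_mul_cancel_right₀ hy.ne', abs_sub_comm]; ring
    _ ≤ (ε : ℝ)⁻¹ * (K * dist x y + K * dist x y) := by
        gcongr
        · exact hgε x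
        · exact (abs_norm_sub_norm_le _ _).trans h1
    _ = _ := by push_cast; ring

/-- Brouwer's fixed point theorem for bounded Lipschitz maps of a Euclidean space. -/
theorem LipschitzWith.exists_isFixedPt_of_norm_le {f : E → E} {K : ℝ≥0} {R : ℝ} (hR : 0 < R)
    (hf : LipschitzWith K f) (hfR : ∀ x, ‖f x‖ ≤ R) : ∃ x, f x = x := by
  by_contra! hne
  -- Cutoff equal to 1 for `‖z‖ ≤ R` and to 0 for `‖z‖ ≥ 2R`. Without fixed points of `f`, `z - φ(z)
  -- f(z)` never vanishes and is the identity far out.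
  set φ : E → ℝ := fun z => max 0 (min 1 (2 - R⁻¹ * ‖z‖)) with hφ
  have hφ0 : ∀ z, 0 ≤ φ z := fun z => le_max_left _ _
  have hφ1 : ∀ z, φ z ≤ 1 := fun z => max_le zero_le_one (min_le_left _ _)
  obtain ⟨a, hφL⟩ : ∃ a : ℝ≥0, LipschitzWith a φ :=
    ⟨_, (((LipschitzWith.const (2 : ℝ)).sub ((lipschitzWith_smul (R⁻¹ : ℝ)).comp
      lipschitzWith_one_norm)).const_min 1).const_max 0⟩
  have hGL : ∃ b : ℝ≥0, LipschitzWith b fun z => z - φ z • f z :=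
    ⟨_, LipschitzWith.id.sub (lipschitzWith_smul_of_norm_le (A := 1) (B := ⟨R, hR.le⟩) hφL hf
      (fun z => by rw [abs_of_nonneg (hφ0 z)]; exact hφ1 z) hfR)⟩
  set G : E → E := fun z => z - φ z • f z with hG
  obtain ⟨b, hGL⟩ := hGL
  have hφf : ∀ z, ‖φ z • f z‖ ≤ R := fun z => by
    rw [norm_smul, Real.norm_of_nonneg (hφ0 z)]
    nlinarith [hφ1 z, hfR z, hφ0 z, norm_nonneg (f z)]
  have hGout : ∀ z, 2 * R ≤ ‖z‖ → G z = z := fun z hz => by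
    have : 2 ≤ R⁻¹ * ‖z‖ := by rw [← div_eq_inv_mul, le_div_iff₀ hR]; exact hz
    have : φ z = 0 := max_eq_left ((min_le_right _ _).trans (by linarith))
    simp [hG, this]
  have hG0 : ∀ z, G z ≠ 0 := fun z hz => by
    have hz' : φ z • f z = z := (sub_eq_zero.1 hz).symm
    have hzR : ‖z‖ ≤ R := hz' ▸ hφf z
    have : R⁻¹ * ‖z‖ ≤ 1 := by rw [← div_eq_inv_mul, div_le_one₀ hR]; exact hzR
    have : φ z = 1 := by
      simp only [hφ]
      rw [min_eq_left (by linarith), max_eq_right zero_le_one]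
    rw [this, one_smul] at hz'
    exact hne z hz'
  obtain ⟨ε, hε, hGε⟩ : ∃ ε : ℝ≥0, 0 < ε ∧ ∀ z, ε ≤ ‖G z‖ := by
    obtain ⟨z₀, -, hz₀⟩ := (isCompact_closedBall (0 : E) (2 * R)).exists_isMinOn
      ⟨0, mem_closedBall_self (by positivity)⟩ hGL.continuous.norm.continuousOn
    have hpos : 0 < min ‖G z₀‖ (2 * R) := lt_min (norm_pos_iff.2 (hG0 z₀)) (by positivity)
    refine ⟨⟨_, hpos.le⟩, hpos, fun z => ?_⟩
    rcases le_total ‖z‖ (2 * R) with h | h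
    · exact (min_le_left _ _).trans (hz₀ (mem_closedBall_zero_iff.2 h))
    · rw [hGout z h]
      exact (min_le_right _ _).trans h
  have h3R : 0 < 3 * R := by positivity
  have hmL : LipschitzWith (1 * b) fun z => max 0 (3 * R - ‖G z‖) := by
    have := (((LipschitzWith.const (3 * R)).sub
      (lipschitzWith_one_norm.comp hGL)).const_max 0)
    simpa using this
  have hrL := hGL.add (lipschitzWith_smul_of_norm_le (A := ⟨3 * R, h3R.le⟩) (B := 1) hmL
    (lipschitzWith_inv_norm_smul hε hGL hGε)
    (fun z => by
      rw [abs_of_nonneg (le_max_left _ _)]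
      exact max_le h3R.le (sub_le_self _ (norm_nonneg _)))
    (fun z => by simp [norm_smul, hG0 z]))
  -- Pushing `G` radially out to norm `3R` sends the whole ball into its sphere, which is
  -- impossible.
  obtain ⟨x, hx, hxR⟩ := (hrL.sub LipschitzWith.id).exists_norm_add_ne (R := 3 * R)
    (by positivity) (fun z hz => by
      rw [hGout z (by linarith), max_eq_left (by linarith)]; simp)
  apply hxR
  have hx : ‖x‖ < 3 * R := mem_ball_zero_iff.1 hx
  have hGx : ‖G x‖ ≤ 3 * R := by
    rcases le_total ‖x‖ (2 * R) with h | h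
    · linarith [hφf x, _root_.norm_sub_le x (φ x • f x)]
    · rw [hGout x h]; exact hx.le
  have hpos : 0 < ‖G x‖ := norm_pos_iff.2 (hG0 x)
  have e : x + (G x + max 0 (3 * R - ‖G x‖) • ‖G x‖⁻¹ • G x - id x)
      = (3 * R * ‖G x‖⁻¹) • G x := by
    rw [max_eq_right (by linarith), id, add_sub_cancel, smul_smul, sub_mul,
      mul_inv_cancel₀ hpos.ne']
    module
  rw [e, norm_smul, Real.norm_of_nonneg (by positivity), inv_mul_cancel_right₀ hpos.ne']

end FixedPoint

/-! ### Complementarity problems for nonnegative matrices -/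

namespace LCP

variable {n : ℕ} {A : Matrix (Fin n) (Fin n) ℝ}

theorem exists_clamp_fixed_point (A : Matrix (Fin n) (Fin n) ℝ) (q : Fin n → ℝ) {M : ℝ}
    (hM : 0 ≤ M) :
    ∃ x : Fin n → ℝ, ∀ i, x i = max 0 (min M (x i - (A.mulVec x + q) i)) := by
  let F : (Fin n → ℝ) → (Fin n → ℝ) := fun x i => max 0 (min M (x i - (A.mulVec x + q) i))
  obtain ⟨K, hK⟩ : ∃ K, LipschitzWith K F := by
    let T : (Fin n → ℝ) →L[ℝ] (Fin n → ℝ) := LinearMap.toContinuousLinearMap A.mulVecLin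
    have h1 := (LipschitzWith.id.sub (T.lipschitz.add (LipschitzWith.const q)))
    exact ⟨_, LipschitzWith.of_dist_le_mul fun x y => (dist_pi_le_iff (by positivity)).2 fun i =>
      ((((LipschitzWith.eval i).comp h1).const_min M).const_max 0).dist_le_mul x y⟩
  -- The sup norm is not an inner product norm, so the map is conjugated to Euclidean space.
  let e := EuclideanSpace.equiv (Fin n) ℝ
  have hbd : ∀ x, ‖F x‖ ≤ M := fun x => (pi_norm_le_iff_of_nonneg hM).2 fun i => by
    rw [Real.norm_of_nonneg (le_max_left _ _)]
    exact max_le hM (min_le_left _ _)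
  obtain ⟨x, hx⟩ := (e.symm.lipschitz.comp (hK.comp e.lipschitz)).exists_isFixedPt_of_norm_le
    (R := ‖(e.symm : (Fin n → ℝ) →L[ℝ] EuclideanSpace ℝ (Fin n))‖ * M + 1) (by positivity)
    (fun x => by
      refine ((e.symm : (Fin n → ℝ) →L[ℝ] EuclideanSpace ℝ (Fin n)).le_opNorm _).trans ?_
      have := mul_le_mul_of_nonneg_left (hbd (e x)) (norm_nonneg
        (e.symm : (Fin n → ℝ) →L[ℝ] EuclideanSpace ℝ (Fin n)))
      simp only [Function.comp_apply]
      linarith)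
  have hx' : F (e x) = e x := by
    have := congrArg e hx
    simpa using this
  exact ⟨e x, fun i => (congrFun hx' i).symm⟩

theorem Nonneg.mulVec_nonneg (hA : Nonneg A) {x : Fin n → ℝ} (hx : 0 ≤ x) : 0 ≤ A.mulVec x :=
  fun i => show 0 ≤ ∑ j, A i j * x j from
    Finset.sum_nonneg fun j _ => mul_nonneg (hA i j) (hx j)

theorem Nonneg.diag_mul_le_mulVec (hA : Nonneg A) {x : Fin n → ℝ} (hx : 0 ≤ x) (i : Fin n) :
    A i i * x i ≤ A.mulVec x i :=
  Finset.single_le_sum (f := fun j => A i j * x j) (fun j _ => mul_nonneg (hA i j) (hx j))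
    (Finset.mem_univ i)

theorem Nonneg.isQMatrix (hA : Nonneg A) (hd : ∀ i, 0 < A i i) : IsQMatrix A := by
  intro q
  obtain ⟨M, hM0, hM⟩ : ∃ M : ℝ, 0 < M ∧ ∀ i, 0 < A i i * M + q i := by
    -- This `M` exceeds every `|q i| / A i i`; hence `x i = M` would make the slack positive,
    -- contradicting the clamp equation.
    refine ⟨1 + ∑ i, |q i| / A i i, ?_, fun i => ?_⟩
    · have : 0 ≤ ∑ i, |q i| / A i i :=
        Finset.sum_nonneg fun i _ => div_nonneg (abs_nonneg _) (hd i).le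
      linarith
    · have h1 : |q i| / A i i ≤ ∑ i, |q i| / A i i :=
        Finset.single_le_sum (f := fun i => |q i| / A i i)
          (fun i _ => div_nonneg (abs_nonneg _) (hd i).le) (Finset.mem_univ i)
      have h2 := mul_le_mul_of_nonneg_left h1 (hd i).le
      rw [mul_div_cancel₀ _ (hd i).ne'] at h2
      nlinarith [hd i, neg_abs_le (q i)]
  obtain ⟨x, hx⟩ := exists_clamp_fixed_point A q hM0.le
  have hx0 : 0 ≤ x := fun i => by rw [hx i]; exact le_max_left _ _
  have hcases : ∀ i, 0 ≤ (A.mulVec x + q) i ∧ x i * (A.mulVec x + q) i = 0 := by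
    intro i
    have hi := hx i
    have hy : x i = M → 0 < (A.mulVec x + q) i := fun h => by
      have := hA.diag_mul_le_mulVec hx0 i
      rw [h] at this
      have := hM i
      rw [Pi.add_apply]
      linarith
    rcases le_total M (x i - (A.mulVec x + q) i) with h | h
    · rw [min_eq_left h, max_eq_right hM0.le] at hi
      linarith [hy hi]
    · rw [min_eq_right h] at hi
      rcases le_total 0 (x i - (A.mulVec x + q) i) with h' | h'
      · rw [max_eq_right h'] at hi
        have : (A.mulVec x + q) i = 0 := by linarith
        simp [this]
      · rw [max_eq_left h'] at hi
        rw [hi] at h' ⊢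
        exact ⟨by linarith, zero_mul _⟩
  exact ⟨x, hx0, fun i => (hcases i).1, Finset.sum_eq_zero fun i _ => (hcases i).2⟩

theorem IsQMatrix.diag_pos (hA : Nonneg A) (hQ : IsQMatrix A) (i : Fin n) : 0 < A i i := by
  by_contra! hi
  have hii : A i i = 0 := le_antisymm hi (hA i i)
  -- Off `i` the slack is at least 1, so `x j = 0`; with `A i i = 0` the slack at `i` is then `-1`.
  let q : Fin n → ℝ := fun j => if j = i then -1 else 1
  obtain ⟨x, hx0, hy0, hxy⟩ := hQ q
  have hcomp : ∀ j, x j * (A.mulVec x + q) j = 0 := fun j =>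
    (Finset.sum_eq_zero_iff_of_nonneg fun j _ => mul_nonneg (hx0 j) (hy0 j)).1 hxy j
      (Finset.mem_univ j)
  have hzero : A.mulVec x i = 0 := by
    refine show ∑ j, A i j * x j = 0 from Finset.sum_eq_zero fun j _ => ?_
    rcases eq_or_ne j i with rfl | hj
    · rw [hii, zero_mul]
    · rcases mul_eq_zero.1 (hcomp j) with h | h
      · rw [h, mul_zero]
      · have := hA.mulVec_nonneg hx0 j
        simp only [q, Pi.add_apply, if_neg hj, Pi.zero_apply] at h this
        linarith
  have := hy0 i
  simp only [q, Pi.add_apply, hzero, if_true, Pi.zero_apply] at this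
  linarith

theorem nonneg_mem_dual_rangeCone {y : Fin n → ℝ} (hy : 0 ≤ y) : y ∈ dual (rangeCone A) :=
  fun _ hx => dotProduct_nonneg_of_nonneg hx.1 hy

theorem Nonneg.coneSolutions_eq (hA : Nonneg A) (hd : ∀ i, 0 < A i i) {d : Fin n → ℝ}
    (hd0 : 0 ≤ d) : coneSolutions A (rangeCone A) d = {0} := by
  refine Set.Subset.antisymm (fun x hx => ?_) (Set.singleton_subset_iff.2 ?_)
  · obtain ⟨⟨hx0 : 0 ≤ x, -⟩, -, hxy⟩ := hx
    have hterm : ∀ j ∈ Finset.univ, 0 ≤ x j * (A.mulVec x + d) j := fun j _ =>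
      mul_nonneg (hx0 j) (add_nonneg (hA.mulVec_nonneg hx0 j) (hd0 j))
    ext j
    have hj := (Finset.sum_eq_zero_iff_of_nonneg hterm).1 hxy j (Finset.mem_univ j)
    rcases mul_eq_zero.1 hj with h | h
    · exact h
    · have h1 := hA.diag_mul_le_mulVec hx0 j
      have h2 : 0 ≤ d j := hd0 j
      have h3 : A.mulVec x j + d j = 0 := h
      have h4 : 0 ≤ x j := hx0 j
      exact le_antisymm (by by_contra! h5; linarith [mul_pos (hd j) h5]) h4
  · exact ⟨⟨le_refl (0 : Fin n → ℝ), 0, by simp⟩, by simpa using nonneg_mem_dual_rangeCone hd0, by simp⟩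

theorem Nonneg.isKaramardian [NeZero n] (hA : Nonneg A) (hd : ∀ i, 0 < A i i) :
    IsKaramardian A := by
  refine ⟨fun h => ?_, hA.coneSolutions_eq hd le_rfl, 1, ?_, hA.coneSolutions_eq hd zero_le_one⟩
  · have hmem : A.mulVec 1 ∈ rangeCone A := ⟨hA.mulVec_nonneg zero_le_one, 1, rfl⟩
    rw [h] at hmem
    have h0 := hA.diag_mul_le_mulVec (x := 1) zero_le_one 0
    rw [Set.mem_singleton_iff.1 hmem] at h0
    have := hd 0
    simp only [Pi.one_apply, mul_one, Pi.zero_apply] at h0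
    linarith
  · rw [mem_interior]
    -- The open positive orthant is a neighbourhood of `1` inside the dual cone.
    refine ⟨Set.univ.pi fun _ => Set.Ioi 0, fun y hy => ?_,
      isOpen_set_pi Set.finite_univ fun _ _ => isOpen_Ioi, fun _ _ => one_pos (α := ℝ)⟩
    exact nonneg_mem_dual_rangeCone fun i => (hy i trivial).le

theorem Nonneg.not_isKaramardian (hA : Nonneg A) (hu : IsUnit A) {i : Fin n} (hi : A i i = 0) :
    ¬ IsKaramardian A := by
  rintro ⟨-, h, -⟩
  have h0 : (0 : Fin n → ℝ) ≤ Pi.single i 1 := Pi.single_nonneg.2 zero_le_one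
  have hmem : Pi.single i 1 ∈ coneSolutions A (rangeCone A) 0 :=
    ⟨⟨h0, Matrix.mulVec_surjective_iff_isUnit.2 hu _⟩,
      nonneg_mem_dual_rangeCone (by simpa using hA.mulVec_nonneg h0), by simp [hi]⟩
  rw [h] at hmem
  simpa using congrFun (Set.mem_singleton_iff.1 hmem) i

end LCP

theorem mainTheorem4 (n : ℕ) (hn : 1 ≤ n) (A : Matrix (Fin n) (Fin n) ℝ) (hA : LCP.Nonneg A) :
    (IsUnit A → (LCP.IsKaramardian A ↔ LCP.IsQMatrix A)) ∧
    (IsUnit A → (∃ i, A i i = 0) → ¬ LCP.IsKaramardian A) ∧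
    ((∀ i, 0 < A i i) → LCP.IsKaramardian A) ∧
    (LCP.IsQMatrix A ↔ ∀ i, 0 < A i i) := by
  have : NeZero n := ⟨by omega⟩
  have hQ : LCP.IsQMatrix A ↔ ∀ i, 0 < A i i := ⟨fun h i => h.diag_pos hA i, hA.isQMatrix⟩
  refine ⟨fun hu => ⟨fun hK => hA.isQMatrix fun i => ?_, fun h => hA.isKaramardian (hQ.1 h)⟩,
    fun hu ⟨_, hi⟩ => hA.not_isKaramardian hu hi, hA.isKaramardian, hQ⟩
  exact (hA i i).lt_of_ne' fun hi => hA.not_isKaramardian hu hi hK
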